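/- Let $I=\{0=t_0<t_1<\dots<t_N=T\}$ and let $\mathcal K\subset\mathbb R^d$ be compact. For a real Hilbert space $H$ put $\widetilde H=\{\mathbf h\in\prod_{n\ge0}H^{\hat\otimes n}:\sum_n\|\mathbf h_n\|^2<\infty\}$, where $H^{\hat\otimes n}$ is the Hilbert tensor power, and for a path $x:I\to H$ define its time-augmented signature $$S_H(x)=\prod_{i=0}^N\exp_\otimes\big(t_i-t_{i-1},\,x_{t_i}-x_{t_{i-1}}\big)\in\widetilde{\mathbb R\oplus H},\qquad t_{-1}:=0,\ x_{t_{-1}}:=0,$$ where $\exp_\otimes(v)=\sum_{n\ge0}v^{\otimes n}/n!$ and the product is the tensor product, taken in increasing order of $i$. Let $\mathcal H^1=\widetilde{\mathbb R\oplus\mathbb R^d}$, $\mathcal H^2=\widetilde{\mathbb R\oplus\mathcal H^1}$, and $S=S_{\mathbb R^d}:(\mathbb R^d)^I\to\mathcal H^1$. For a path $\mu=(\mu_t)_{t\in I}$ of probability measures on $\mathcal K^I$ let $\bar\mu_t=\int S(x)\,\mu_t(dx)\in\mathcal H^1$ and $S^2(\mu)=S_{\mathcal H^1}(t\mapsto\bar\mu_t)\in\mathcal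 H^2$. Let $(\Omega,\mathcal F,\mathbb P)$ and $(\Omega',\mathcal G,\mathbb Q)$ be probability spaces with filtrations $(\mathcal F_t)_{t\in I}$ and $(\mathcal G_t)_{t\in I}$, and let $X=(X_t)_{t\in I}$ and $Y=(Y_t)_{t\in I}$ be $\mathcal K$-valued processes on them, adapted to these filtrations. Let $\hat X^1_t=\mathbb P[X\in\cdot\mid\mathcal F_t]$ and $\hat Y^1_t=\mathbb Q[Y\in\cdot\mid\mathcal G_t]$, $t\in I$ (regular conditional distributions of the whole path), be their rank-1 prediction processes. Then the expectations $\mathbb E_{\mathbb P}[S(X)]$, $\mathbb E_{\mathbb Q}[S(Y)]$ in $\mathcal H^1$ and $\mathbb E_{\mathbb P}[S^2(\hat X^1)]$, $\mathbb E_{\mathbb Q}[S^2(\hat Y^1)]$ in $\mathcal H^2$ exist as Bochner integrals, and $$\mathcal L(X)=\mathcal L(Y)\iff\mathbb E_{\mathbb P}[S(X)]=\mathbb E_{\mathbb Q}[S(Y)],$$ $$\mathcal L(\hat X^1)=\mathcal L(\hat Y^1)\iff\mathbb E_{\mathbb P}[S^2(\hat X^1)]=\mathbb E_{\mathbb Q}[S^2(\hat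 Y^1)].$$ -/

import Mathlib

open MeasureTheory ProbabilityTheory
open scoped ENNReal Nat

namespace RankTwoSignature

noncomputable section

/-- `ℓ²(A)`: the real Hilbert space with orthonormal basis indexed by `A`. -/
abbrev EllTwo (A : Type*) : Type _ := lp (fun _ : A => ℝ) 2

/-- The Hilbert space `{h ∈ ∏ₙ H^{⊗̂n} : ∑ₙ ‖hₙ‖² < ∞}` for `H = ℓ²(A)`.  The completed tensor power
`H^{⊗̂n}` has the orthonormal basis `e_{a₁} ⊗ ⋯ ⊗ e_{aₙ}`, indexed by the words `[a₁, …, aₙ]` of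
length `n`, so an element is given by its coefficients on all words, and its squared norm is the
sum of the squares of all these coefficients. -/
abbrev TensorHilbert (A : Type*) : Type _ := EllTwo (List A)

/-- The tensor exponential `∑ₙ v^{⊗n} / n!`: the coefficient at `[a₁, …, aₙ]` is
`v a₁ ⋯ v aₙ / n!`. -/
def tensorExp {A : Type*} (v : A → ℝ) (w : List A) : ℝ :=
  (w.map v).prod / (w.length)!

/-- The unit `1 ∈ H^{⊗0} = ℝ` of the tensor algebra. -/
def tensorOne {A : Type*} (w : List A) : ℝ :=
  if w.length = 0 then 1 else 0

/-- The tensor (concatenation) product: the coefficient at `w` is the sum of `f u * g v` over all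
splittings of `w` as a word `u` followed by a word `v`. -/
def tensorMul {A : Type*} (f g : List A → ℝ) (w : List A) : ℝ :=
  ∑ k ∈ Finset.range (w.length + 1), f (w.take k) * g (w.drop k)

/-- The increments `x₀ - 0, x₁ - x₀, …, x_N - x_{N-1}` of a discrete path. -/
def increment {E : Type*} [AddGroup E] {N : ℕ} (x : Fin (N + 1) → E) (i : Fin (N + 1)) : E :=
  Fin.cases (x 0) (fun j : Fin N => x j.succ - x j.castSucc) i

/-- The vector `(s, h) ∈ ℝ ⊕ ℓ²(A) = ℓ²(Option A)`; `none` is the coordinate of `ℝ`. -/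
def augment {A : Type*} (s : ℝ) (h : EllTwo A) : Option A → ℝ :=
  fun o => o.elim s fun a => h a

/-- The coefficients of the time-augmented signature
`∏_{i=0}^N exp_⊗ (tᵢ - tᵢ₋₁, xᵢ - xᵢ₋₁)`, with `t₋₁ = 0` and `x₋₁ = 0`; the factors are multiplied
in increasing order of `i` from left to right. -/
def signatureCoeff {A : Type*} {N : ℕ} (t : Fin (N + 1) → ℝ) (x : Fin (N + 1) → EllTwo A) :
    List (Option A) → ℝ :=
  (List.ofFn fun i => tensorExp (augment (increment t i) (increment x i))).foldr
    tensorMul tensorOne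

/-! The coefficients of a signature are square-summable. -/

/-- Square-summability with all exponential weights in the word length. -/
def StronglySummable {A : Type*} (f : List A → ℝ) : Prop :=
  ∀ R : ℝ, 0 < R → Summable fun w => R ^ w.length * f w ^ 2

theorem summable_sq {A : Type*} (x : EllTwo A) : Summable fun a => x a ^ 2 := by
  have h := (memℓp_gen_iff (p := 2) (by norm_num)).1 (lp.memℓp x)
  simpa using h

theorem summable_augment {A : Type*} (s : ℝ) (x : EllTwo A) :
    Summable fun o => augment s x o ^ 2 := by
  rw [← (Equiv.optionEquivSumPUnit.{0} A).symm.summable_iff]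
  refine Summable.sum _ ?_ ?_
  · simpa [Function.comp_def, augment] using summable_sq x
  · exact (hasSum_fintype _).summable

theorem stronglySummable_tensorOne {A : Type*} : StronglySummable (tensorOne (A := A)) := by
  intro R _
  refine summable_of_ne_finset_zero (s := {[]}) fun w hw => ?_
  have : w.length ≠ 0 := by simpa using hw
  simp [tensorOne, this]

theorem sum_prod_sq_le {A : Type*} {v : A → ℝ} (hv : Summable fun a => v a ^ 2) (n : ℕ)
    (s : Finset (Fin n → A)) : ∑ p ∈ s, ∏ i, v (p i) ^ 2 ≤ (∑' a, v a ^ 2) ^ n := by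
  classical
  let B : Finset A := s.biUnion fun p => Finset.univ.image p
  have hs : s ⊆ Fintype.piFinset fun _ : Fin n => B := by
    intro p hp
    rw [Fintype.mem_piFinset]
    intro i
    exact Finset.mem_biUnion.2 ⟨p, hp, Finset.mem_image_of_mem _ (Finset.mem_univ i)⟩
  calc ∑ p ∈ s, ∏ i, v (p i) ^ 2
      ≤ ∑ p ∈ Fintype.piFinset fun _ : Fin n => B, ∏ i, v (p i) ^ 2 :=
        Finset.sum_le_sum_of_subset_of_nonneg hs
          fun p _ _ => Finset.prod_nonneg fun i _ => sq_nonneg _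
    _ = (∑ a ∈ B, v a ^ 2) ^ n := (Finset.sum_pow' B (fun a => v a ^ 2) n).symm
    _ ≤ (∑' a, v a ^ 2) ^ n :=
        pow_le_pow_left₀ (Finset.sum_nonneg fun a _ => sq_nonneg _)
          (hv.sum_le_tsum B fun a _ => sq_nonneg _) n

theorem tensorExp_ofFn {A : Type*} (v : A → ℝ) (R : ℝ) {n : ℕ} (p : Fin n → A) :
    R ^ (List.ofFn p).length * tensorExp v (List.ofFn p) ^ 2 =
      (R ^ n / (n ! : ℝ) ^ 2) * ∏ i, v (p i) ^ 2 := by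
  have : (List.map v (List.ofFn p)).prod = ∏ i, v (p i) := by
    rw [List.map_ofFn, List.prod_ofFn]; rfl
  rw [tensorExp, this, List.length_ofFn, div_pow, ← Finset.prod_pow]
  ring

theorem summable_prod_sq {A : Type*} {v : A → ℝ} (hv : Summable fun a => v a ^ 2) (n : ℕ) :
    Summable fun p : Fin n → A => ∏ i, v (p i) ^ 2 :=
  summable_of_sum_le (fun _ => Finset.prod_nonneg fun _ _ => sq_nonneg _) (sum_prod_sq_le hv n)

theorem stronglySummable_tensorExp {A : Type*} {v : A → ℝ} (hv : Summable fun a => v a ^ 2) :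
    StronglySummable (tensorExp v) := by
  intro R hR
  have h0 : ∀ q : (n : ℕ) × (Fin n → A), 0 ≤ R ^ q.1 / (q.1 ! : ℝ) ^ 2 * ∏ i, v (q.2 i) ^ 2 :=
    fun q => mul_nonneg (by positivity) (Finset.prod_nonneg fun i _ => sq_nonneg _)
  have hsum : Summable fun q : (n : ℕ) × (Fin n → A) =>
      R ^ q.1 / (q.1 ! : ℝ) ^ 2 * ∏ i, v (q.2 i) ^ 2 := by
    rw [summable_sigma_of_nonneg h0]
    refine ⟨fun n => (summable_prod_sq hv n).mul_left (R ^ n / (n ! : ℝ) ^ 2), ?_⟩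
    refine Summable.of_nonneg_of_le (fun n => tsum_nonneg fun p => h0 ⟨n, p⟩) (fun n => ?_)
      (Real.summable_pow_div_factorial (R * ∑' a, v a ^ 2))
    dsimp only
    rw [tsum_mul_left]
    have h1 : ∑' p : Fin n → A, ∏ i, v (p i) ^ 2 ≤ (∑' a, v a ^ 2) ^ n :=
      (summable_prod_sq hv n).tsum_le_of_sum_le (sum_prod_sq_le hv n)
    have h2 : (1 : ℝ) ≤ (n ! : ℝ) := by exact_mod_cast n.factorial_pos
    have h3 : R ^ n / (n ! : ℝ) ^ 2 ≤ R ^ n / (n ! : ℝ) :=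
      div_le_div_of_nonneg_left (by positivity) (by positivity) (by nlinarith)
    calc R ^ n / (n ! : ℝ) ^ 2 * ∑' p : Fin n → A, ∏ i, v (p i) ^ 2
        ≤ R ^ n / (n ! : ℝ) * (∑' a, v a ^ 2) ^ n :=
          mul_le_mul h3 h1 (tsum_nonneg fun p => Finset.prod_nonneg fun i _ => sq_nonneg _)
            (by positivity)
      _ = (R * ∑' a, v a ^ 2) ^ n / (n ! : ℝ) := by rw [mul_pow]; ring
  refine List.equivSigmaTuple.symm.summable_iff.1 (hsum.congr fun q => ?_)
  exact (tensorExp_ofFn v R q.2).symm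

theorem StronglySummable.tensorMul {A : Type*} {f g : List A → ℝ} (hf : StronglySummable f)
    (hg : StronglySummable g) : StronglySummable (tensorMul f g) := by
  intro R hR
  have hF := hf (2 * R) (by positivity)
  have hG := hg (2 * R) (by positivity)
  have hFG := hF.mul_of_nonneg hG (fun w => by dsimp; positivity) (fun w => by dsimp; positivity)
  let e : ((w : List A) × Fin (w.length + 1)) → List A × List A :=
    fun q => (q.1.take q.2, q.1.drop q.2)
  have he : Function.Injective e := by
    rintro ⟨w, k⟩ ⟨w', k'⟩ h
    simp only [e, Prod.mk.injEq] at h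
    obtain ⟨h1, h2⟩ := h
    have hw : w = w' := by
      rw [← List.take_append_drop k w, h1, h2, List.take_append_drop]
    subst hw
    have hl := congrArg List.length h1
    simp only [List.length_take] at hl
    have : k = k' := by
      apply Fin.ext
      have := k.2
      have := k'.2
      omega
    rw [this]
  refine Summable.of_nonneg_of_le (fun w => by positivity) (fun w => ?_)
    (hFG.comp_injective he).sigma
  simp only [tsum_fintype, Function.comp, e]
  rw [Fin.sum_univ_eq_sum_range (fun k => (2 * R) ^ (w.take k).length * f (w.take k) ^ 2 *
    ((2 * R) ^ (w.drop k).length * g (w.drop k) ^ 2)) (w.length + 1)]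
  have h1 := sq_sum_le_card_mul_sum_sq (s := Finset.range (w.length + 1))
    (f := fun k => f (w.take k) * g (w.drop k))
  have h2 : ((w.length + 1 : ℕ) : ℝ) ≤ 2 ^ w.length := by
    exact_mod_cast Nat.lt_two_pow_self (n := w.length)
  rw [Finset.card_range] at h1
  calc R ^ w.length * RankTwoSignature.tensorMul f g w ^ 2
      ≤ R ^ w.length * (2 ^ w.length *
          ∑ k ∈ Finset.range (w.length + 1), (f (w.take k) * g (w.drop k)) ^ 2) := by
        refine mul_le_mul_of_nonneg_left (h1.trans ?_) (by positivity)
        exact mul_le_mul_of_nonneg_right h2 (Finset.sum_nonneg fun k _ => sq_nonneg _)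
    _ = _ := by
        rw [← mul_assoc, ← mul_pow, Finset.mul_sum]
        refine Finset.sum_congr rfl fun k _ => ?_
        have hl : (w.take k).length + (w.drop k).length = w.length := by
          rw [← List.length_append, List.take_append_drop]
        rw [← hl, pow_add]
        ring

theorem memℓp_signatureCoeff {A : Type*} {N : ℕ} (t : Fin (N + 1) → ℝ)
    (x : Fin (N + 1) → EllTwo A) : Memℓp (signatureCoeff t x) 2 := by
  have h : StronglySummable (signatureCoeff t x) := by
    have hl : ∀ l : List (List (Option A) → ℝ), (∀ f ∈ l, StronglySummable f) →
        StronglySummable (l.foldr RankTwoSignature.tensorMul tensorOne) := by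
      intro l
      induction l with
      | nil => exact fun _ => stronglySummable_tensorOne
      | cons f l ih =>
        intro hl
        exact (hl f List.mem_cons_self).tensorMul
          (ih fun g hg => hl g (List.mem_cons_of_mem _ hg))
    refine hl _ fun f hf => ?_
    obtain ⟨i, rfl⟩ := List.mem_ofFn.1 hf
    exact stronglySummable_tensorExp (summable_augment _ _)
  refine memℓp_gen ?_
  simpa using h 1 one_pos

/-- The time-augmented signature of a discrete path `x` in `ℓ²(A)` on the time grid `t`. -/
def signature {A : Type*} {N : ℕ} (t : Fin (N + 1) → ℝ) (x : Fin (N + 1) → EllTwo A) :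
    TensorHilbert (Option A) :=
  ⟨signatureCoeff t x, memℓp_signatureCoeff t x⟩

/-- Paths in `ℝ^d` on a grid with `N + 1` points. -/
abbrev PathSpace (N d : ℕ) : Type := Fin (N + 1) → EuclideanSpace ℝ (Fin d)

/-- `ℝ^d` as `ℓ²` of the `d` coordinates. -/
def toEllTwo {d : ℕ} (v : EuclideanSpace ℝ (Fin d)) : EllTwo (Fin d) :=
  ⟨fun j => v j, Memℓp.all _⟩

/-- The Hilbert space built on `ℝ ⊕ ℝ^d`. -/
abbrev HilbertOne (d : ℕ) : Type := TensorHilbert (Option (Fin d))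

/-- The Hilbert space built on `ℝ ⊕ HilbertOne d`. -/
abbrev HilbertTwo (d : ℕ) : Type := TensorHilbert (Option (List (Option (Fin d))))

/-- The time-augmented signature `S` of an `ℝ^d`-valued path. -/
def sigOne {N d : ℕ} (t : Fin (N + 1) → ℝ) (x : PathSpace N d) : HilbertOne d :=
  signature t fun i => toEllTwo (x i)

/-- The rank-2 signature `S²` of a measure-valued path: the signature of the path of expected
signatures `∫ S(x) μᵢ(dx)` (Bochner integrals). -/
def sigTwo {N d : ℕ} (t : Fin (N + 1) → ℝ) (μ : Fin (N + 1) → ProbabilityMeasure (PathSpace N d)) :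
    HilbertTwo d :=
  signature t fun i => ∫ x, sigOne t x ∂(μ i : Measure (PathSpace N d))

/-- The path `ω ↦ (X₀(ω), …, X_N(ω))` of a process. -/
def pathOf {Ω : Type*} {N d : ℕ} (X : Fin (N + 1) → Ω → EuclideanSpace ℝ (Fin d)) (ω : Ω) :
    PathSpace N d :=
  fun i => X i ω

/-- The (rank-1) prediction process: at time `i` it is the regular conditional distribution
`P[X ∈ · | ℱ i]` of the whole path, that is, the conditional distribution of `X` given the identity
map into `(Ω, ℱ i)`. -/
def prediction {Ω : Type*} {mΩ : MeasurableSpace Ω} {N d : ℕ} (P : Measure Ω)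
    [IsProbabilityMeasure P] (ℱ : Filtration (Fin (N + 1)) mΩ)
    (X : Fin (N + 1) → Ω → EuclideanSpace ℝ (Fin d)) (ω : Ω) (i : Fin (N + 1)) :
    ProbabilityMeasure (PathSpace N d) :=
  letI κ : @Kernel Ω (PathSpace N d) (ℱ i) _ :=
    @condDistrib Ω Ω (PathSpace N d) _ _ _ mΩ (ℱ i) (pathOf X) id P _
  ⟨κ ω, by
    have := @instIsMarkovKernelCondDistrib
    infer_instance⟩

/-- All the expectations in the definition of the expected signatures `E[S(X)]` and `E[S²(X̂)]`
exist as Bochner integrals. -/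
def HasExpectedSignatures {Ω : Type*} {mΩ : MeasurableSpace Ω} {N d : ℕ} (t : Fin (N + 1) → ℝ)
    (P : Measure Ω) [IsProbabilityMeasure P] (ℱ : Filtration (Fin (N + 1)) mΩ)
    (X : Fin (N + 1) → Ω → EuclideanSpace ℝ (Fin d)) : Prop :=
  Integrable (fun ω => sigOne t (pathOf X ω)) P ∧
  (∀ i, ∀ᵐ ω ∂P,
    Integrable (sigOne t) (prediction P ℱ X ω i : Measure (PathSpace N d))) ∧
  Integrable (fun ω => sigTwo t (prediction P ℱ X ω)) P

end

end RankTwoSignature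

open RankTwoSignature

/-! Each coefficient of a signature is a polynomial in finitely many coordinates of the path, and a
product of two coefficients is the sum of the coefficients over all shuffles of the two words
(`boxSig_mul`). The linear span of the coefficients is therefore an algebra of continuous functions
containing 1. Because time is one of the coordinates, it separates paths (`pathSig_injective`), with
no tree-like exceptions. On a product of compact intervals, which is compact by Tychonoff's theorem
even with infinitely many factors, Stone-Weierstrass makes the span dense (`closure_span_boxSig`).
Expected signatures hence determine the integrals of all continuous functions, and so the law. This
is the first equivalence.

The argument uses the product topology on coordinates, not the norm topology of `ℓ²`, so it applies
unchanged to paths in `ℓ²(A)` with `A` countable, as long as one sequence bounds all coordinates.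
Paths of expected signatures satisfy this: signatures of bounded paths are dominated coefficientwise
by one element of `ℓ²`, and averaging keeps the bound (`exists_forall_abs_expectedSigCoord_le`). The
expected rank-2 signature thus determines the law of the path of expected signatures of the
prediction process.

It remains to return from expected signatures to measures. Injectivity alone does not identify laws;
the expected signatures must also generate the σ-algebra on measures. The same density gives this:
the property "the integral depends measurably on the measure" passes from signature coefficients to
all continuous functions (`measurable_boxMeasure`, `exists_preimage_expectedSigCoord`). The converse
implications hold because both expectations are integrals against the laws. -/

namespace RankTwoSignature

/-! ### Shuffles of words and characters of the shuffle algebra -/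

section Shuffle

variable {B : Type*}

/-- The list of all shuffles of two words, with multiplicity. -/
def shuffle : List B → List B → List (List B)
  | [], v => [v]
  | a :: u, [] => [a :: u]
  | a :: u, b :: v =>
    (shuffle u (b :: v)).map (List.cons a) ++ (shuffle (a :: u) v).map (List.cons b)
termination_by u v => u.length + v.length

/-- The sum of the values of `f` over all shuffles of `u` and `v`. -/
def shuffleSum (f : List B → ℝ) (u v : List B) : ℝ := ((shuffle u v).map f).sum

theorem shuffleSum_nil_left (f : List B → ℝ) (v : List B) : shuffleSum f [] v = f v := by
  simp [shuffleSum, shuffle]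

theorem shuffleSum_nil_right (f : List B → ℝ) (u : List B) : shuffleSum f u [] = f u := by
  cases u <;> simp [shuffleSum, shuffle]

theorem shuffleSum_cons_cons (f : List B → ℝ) (a b : B) (u v : List B) :
    shuffleSum f (a :: u) (b :: v) =
      shuffleSum (fun w => f (a :: w)) u (b :: v) +
        shuffleSum (fun w => f (b :: w)) (a :: u) v := by
  simp [shuffleSum, shuffle, Function.comp_def]

theorem shuffleSum_add (f g : List B → ℝ) (u v : List B) :
    shuffleSum (fun w => f w + g w) u v = shuffleSum f u v + shuffleSum g u v := by
  simp [shuffleSum, List.sum_map_add]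

theorem shuffleSum_const_mul (c : ℝ) (f : List B → ℝ) (u v : List B) :
    shuffleSum (fun w => c * f w) u v = c * shuffleSum f u v := by
  simp [shuffleSum, List.sum_map_mul_left]

theorem perm_of_mem_shuffle (u v : List B) : ∀ w ∈ shuffle u v, w.Perm (u ++ v) := by
  induction u, v using shuffle.induct with
  | case1 v => simp [shuffle]
  | case2 a u => simp [shuffle]
  | case3 a u b v ih₁ ih₂ =>
    intro w hw
    rw [shuffle, List.mem_append, List.mem_map, List.mem_map] at hw
    rcases hw with ⟨z, hz, rfl⟩ | ⟨z, hz, rfl⟩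
    · exact (ih₁ z hz).cons a
    · exact ((ih₂ z hz).cons b).trans List.perm_middle.symm

theorem length_shuffle (u v : List B) :
    (shuffle u v).length = (u.length + v.length).choose u.length := by
  induction u, v using shuffle.induct with
  | case1 v => simp [shuffle]
  | case2 a u => simp [shuffle]
  | case3 a u b v ih₁ ih₂ =>
    rw [shuffle, List.length_append, List.length_map, List.length_map, ih₁, ih₂]
    simp only [List.length_cons]
    rw [show u.length + 1 + (v.length + 1) = (u.length + (v.length + 1)) + 1 by omega,
      Nat.choose_succ_succ, show u.length + 1 + v.length = u.length + (v.length + 1) by omega]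

/-- `f` is multiplicative for the shuffle product. -/
def IsShuffleCharacter (f : List B → ℝ) : Prop :=
  ∀ u v, shuffleSum f u v = f u * f v

/-- Every shuffle is a permutation of `u ++ v`, so all of them have the same coefficient; their
number, a binomial coefficient, turns `1 / (m + n)!` into `1 / (m! n!)`. -/
theorem isShuffleCharacter_tensorExp (x : B → ℝ) : IsShuffleCharacter (tensorExp x) := by
  intro u v
  have h : (shuffle u v).map (tensorExp x) =
      (shuffle u v).map fun _ => ((u.map x).prod * (v.map x).prod) / (u.length + v.length)! := by
    refine List.map_congr_left fun w hw => ?_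
    have hp := perm_of_mem_shuffle u v w hw
    rw [tensorExp, (hp.map x).prod_eq, hp.length_eq, List.map_append, List.prod_append,
      List.length_append]
  rw [shuffleSum, h, List.map_const', List.sum_replicate, length_shuffle, nsmul_eq_mul,
    Nat.cast_add_choose, tensorExp, tensorExp]
  have h1 : ((u.length + v.length)! : ℝ) ≠ 0 := by positivity
  field_simp

theorem isShuffleCharacter_tensorOne : IsShuffleCharacter (tensorOne (A := B)) := by
  intro u v
  rcases u with _ | ⟨a, u⟩
  · simp [shuffleSum_nil_left, tensorOne]
  · have h : (shuffle (a :: u) v).map tensorOne = (shuffle (a :: u) v).map fun _ => (0 : ℝ) := by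
      refine List.map_congr_left fun w hw => ?_
      have hl := (perm_of_mem_shuffle _ v w hw).length_eq
      rw [List.length_append, List.length_cons] at hl
      rw [tensorOne, if_neg (by omega)]
    rw [shuffleSum, h]
    simp [tensorOne]

theorem tensorMul_nil (f g : List B → ℝ) : tensorMul f g [] = f [] * g [] := by
  simp [tensorMul]

theorem tensorMul_cons (f g : List B → ℝ) (a : B) (w : List B) :
    tensorMul f g (a :: w) = f [] * g (a :: w) + tensorMul (fun z => f (a :: z)) g w := by
  rw [tensorMul, List.length_cons, Finset.sum_range_succ', add_comm]
  simp [tensorMul]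

/-- Deconcatenation respects shuffles: cutting a shuffle of `u` and `v` in two amounts to cutting
`u` and `v` separately and shuffling the prefixes and the suffixes. Consequently the convolution
`tensorMul` of two characters is a character. -/
theorem shuffleSum_tensorMul (f g : List B → ℝ) (u v : List B) :
    shuffleSum (tensorMul f g) u v =
      ∑ j ∈ Finset.range (u.length + 1), ∑ k ∈ Finset.range (v.length + 1),
        shuffleSum f (u.take j) (v.take k) * shuffleSum g (u.drop j) (v.drop k) := by
  induction u, v using shuffle.induct generalizing f g with
  | case1 v => simp [shuffleSum_nil_left, tensorMul]
  | case2 a u => simp [shuffleSum_nil_right, tensorMul]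
  | case3 a u b v ih₁ ih₂ =>
    rw [shuffleSum_cons_cons]
    -- Either the left part of the cut is empty, or it contains the first letter. In the second case
    -- the induction hypothesis applies to `f` with that letter prepended, hence the generalization
    -- over `f`.
    simp_rw [tensorMul_cons, shuffleSum_add, shuffleSum_const_mul]
    rw [ih₁, ih₂]
    simp only [List.length_cons]
    rw [Finset.sum_range_succ' _ (u.length + 1)]
    simp_rw [Finset.sum_range_succ' _ (v.length + 1)]
    rw [Finset.sum_range_succ' _ (u.length + 1)]
    simp only [List.take_succ_cons, List.drop_succ_cons, List.take_zero, List.drop_zero,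
      shuffleSum_nil_left, shuffleSum_nil_right, shuffleSum_cons_cons g, shuffleSum_cons_cons f,
      add_mul, Finset.sum_add_distrib]
    ring

theorem IsShuffleCharacter.tensorMul {f g : List B → ℝ} (hf : IsShuffleCharacter f)
    (hg : IsShuffleCharacter g) : IsShuffleCharacter (tensorMul f g) := by
  intro u v
  rw [shuffleSum_tensorMul, RankTwoSignature.tensorMul, RankTwoSignature.tensorMul,
    Finset.sum_mul_sum]
  refine Finset.sum_congr rfl fun j _ => Finset.sum_congr rfl fun k _ => ?_
  rw [hf, hg]
  ring

end Shuffle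

/-! ### Products of tensor exponentials -/

section ExpProd

variable {B : Type*}

/-- The tensor product of the exponentials of the vectors `v 0, …, v (n - 1)`. -/
noncomputable def expProd {n : ℕ} (v : Fin n → B → ℝ) : List B → ℝ :=
  (List.ofFn fun i => tensorExp (v i)).foldr tensorMul tensorOne

theorem expProd_zero (v : Fin 0 → B → ℝ) : expProd v = tensorOne := by
  simp [expProd]

theorem expProd_succ {n : ℕ} (v : Fin (n + 1) → B → ℝ) :
    expProd v = tensorMul (tensorExp (v 0)) (expProd fun i => v i.succ) := by
  simp [expProd, List.ofFn_succ]

theorem isShuffleCharacter_expProd {n : ℕ} (v : Fin n → B → ℝ) :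
    IsShuffleCharacter (expProd v) := by
  induction n with
  | zero => rw [expProd_zero]; exact isShuffleCharacter_tensorOne
  | succ n ih => rw [expProd_succ]; exact (isShuffleCharacter_tensorExp _).tensorMul (ih _)

theorem tensorExp_nil (x : B → ℝ) : tensorExp x [] = 1 := by simp [tensorExp]

theorem expProd_nil {n : ℕ} (v : Fin n → B → ℝ) : expProd v [] = 1 := by
  induction n with
  | zero => simp [expProd_zero, tensorOne]
  | succ n ih => rw [expProd_succ, tensorMul_nil, tensorExp_nil, ih, one_mul]

theorem stronglySummable_expProd {n : ℕ} {v : Fin n → B → ℝ}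
    (hv : ∀ i, Summable fun b => v i b ^ 2) : StronglySummable (expProd v) := by
  induction n with
  | zero => rw [expProd_zero]; exact stronglySummable_tensorOne
  | succ n ih =>
    rw [expProd_succ]
    exact (stronglySummable_tensorExp (hv 0)).tensorMul (ih fun i => hv i.succ)

theorem abs_tensorExp_le {x m : B → ℝ} (h : ∀ b, |x b| ≤ m b) (w : List B) :
    |tensorExp x w| ≤ tensorExp m w := by
  rw [tensorExp, tensorExp, abs_div, Nat.abs_cast]
  refine div_le_div_of_nonneg_right ?_ (by positivity)
  induction w with
  | nil => simp
  | cons b w ih =>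
    simp only [List.map_cons, List.prod_cons, abs_mul]
    exact mul_le_mul (h b) ih (abs_nonneg _) ((abs_nonneg _).trans (h b))

/-- The coefficients are polynomials in the entries of the vectors with nonnegative coefficients,
hence monotone under majorants. -/
theorem abs_expProd_le {n : ℕ} {v m : Fin n → B → ℝ} (h : ∀ i b, |v i b| ≤ m i b)
    (w : List B) : |expProd v w| ≤ expProd m w := by
  induction n generalizing w with
  | zero =>
    rw [expProd_zero, expProd_zero, tensorOne]
    split_ifs <;> simp
  | succ n ih =>
    rw [expProd_succ, expProd_succ]
    refine (Finset.abs_sum_le_sum_abs _ _).trans (Finset.sum_le_sum fun k _ => ?_)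
    rw [abs_mul]
    exact mul_le_mul (abs_tensorExp_le (h 0) _) (ih (fun i => h i.succ) _) (abs_nonneg _)
      ((abs_nonneg _).trans (abs_tensorExp_le (h 0) _))

theorem continuous_tensorExp (w : List B) : Continuous fun x : B → ℝ => tensorExp x w := by
  unfold tensorExp
  refine Continuous.div_const ?_ _
  induction w with
  | nil => simpa using continuous_const
  | cons b w ih =>
    simp only [List.map_cons, List.prod_cons]
    exact (continuous_apply b).mul ih

theorem continuous_expProd {n : ℕ} (w : List B) :
    Continuous fun v : Fin n → B → ℝ => expProd v w := by
  induction n generalizing w with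
  | zero => simpa [expProd_zero] using continuous_const
  | succ n ih =>
    simp_rw [expProd_succ, tensorMul]
    refine continuous_finsetSum _ fun k _ => ?_
    exact ((continuous_tensorExp _).comp (continuous_apply 0)).mul
      ((ih _).comp (by fun_prop : Continuous fun (v : Fin (n + 1) → B → ℝ) i => v (Fin.succ i)))

end ExpProd

/-! ### The time-augmented signature of a path separates paths -/

section Separation

open PowerSeries

/-- The power series of `exp (s X)`. -/
noncomputable def expSeries (s : ℝ) : PowerSeries ℝ := rescale s (exp ℝ)

theorem coeff_expSeries (s : ℝ) (k : ℕ) : coeff k (expSeries s) = s ^ k / k ! := by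
  simp [expSeries, coeff_rescale, coeff_exp, div_eq_mul_inv]

theorem expSeries_mul (r s : ℝ) : expSeries r * expSeries s = expSeries (r + s) :=
  exp_mul_exp_eq_exp_add r s

theorem expSeries_zero : expSeries 0 = 1 := by
  ext k
  rw [coeff_expSeries, coeff_one]
  rcases k with _ | k <;> simp

/-- The power series of `(exp (s X) - 1) / (s X)`. -/
noncomputable def expDivSeries (s : ℝ) : PowerSeries ℝ := mk fun k => s ^ k / (k + 1)!

theorem X_mul_expDivSeries (s : ℝ) : C s * (X * expDivSeries s) = expSeries s - 1 := by
  ext k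
  rw [coeff_C_mul, map_sub, coeff_expSeries, coeff_one]
  rcases k with _ | k
  · simp
  · rw [coeff_succ_X_mul, expDivSeries, coeff_mk]
    simp only [Nat.add_eq_zero_iff, one_ne_zero, and_false, if_false, sub_zero]
    ring

variable {A : Type*}

/-- The generating series of the coefficients of `G` at the words `none ⋯ none (some a)`. -/
noncomputable def timeSeries (G : List (Option A) → ℝ) (a : A) : PowerSeries ℝ :=
  mk fun k => G (List.replicate k none ++ [some a])

/-- Cutting `none ⋯ none (some a)` leaves the last letter either to `G`, which gives a Cauchy
product with pure time coefficients, or to the exponential, which then takes the whole word of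
length `k + 1`. -/
theorem timeSeries_tensorMul (y : Option A → ℝ) (G : List (Option A) → ℝ) (a : A) :
    timeSeries (tensorMul (tensorExp y) G) a =
      expSeries (y none) * timeSeries G a + C (y (some a) * G []) * expDivSeries (y none) := by
  ext k
  rw [timeSeries, coeff_mk, map_add, coeff_C_mul, coeff_mul,
    Finset.Nat.sum_antidiagonal_eq_sum_range_succ
      (fun i j => coeff i (expSeries (y none)) * coeff j (timeSeries G a)), tensorMul]
  simp only [List.length_append, List.length_replicate, List.length_singleton]
  rw [Finset.sum_range_succ]
  congr 1
  · refine Finset.sum_congr rfl fun j hj => ?_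
    have hj' : j ≤ k := Nat.lt_succ_iff.1 (Finset.mem_range.1 hj)
    rw [coeff_expSeries, timeSeries, coeff_mk, List.take_append_of_le_length (by simpa),
      List.drop_append_of_le_length (by simpa), List.take_replicate, List.drop_replicate,
      min_eq_left hj']
    simp [tensorExp]
  · rw [List.take_of_length_le (by simp), List.drop_of_length_le (by simp), expDivSeries, coeff_mk]
    simp [tensorExp]
    ring

/-- The prefactor accounts for the time elapsed before the first factor; it is what lets the
induction move the starting time from `s 0` to `s 1`. -/
theorem timeSeries_expProd {n : ℕ} (s : Fin (n + 1) → ℝ) (v : Fin n → Option A → ℝ)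
    (hv : ∀ i, v i none = s i.succ - s i.castSucc) (a : A) :
    expSeries (s 0) * timeSeries (expProd v) a =
      ∑ i, C (v i (some a)) * (expSeries (s i.castSucc) *
        expDivSeries (s i.succ - s i.castSucc)) := by
  induction n with
  | zero =>
    have : timeSeries (expProd v) a = 0 := by
      ext k
      simp [timeSeries, expProd_zero, tensorOne]
    simp [this]
  | succ n ih =>
    have h := ih (fun i => s i.succ) (fun i => v i.succ) fun i => hv i.succ
    rw [expProd_succ, timeSeries_tensorMul, hv 0, mul_add, ← mul_assoc, expSeries_mul,
      Fin.castSucc_zero, add_sub_cancel, h, expProd_nil, Fin.sum_univ_succ, add_comm,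
      Fin.castSucc_zero, mul_one, mul_left_comm]
    simp only [Fin.succ_castSucc]

/-- The time-augmented increments of a path given by its coordinates. -/
noncomputable def pathIncrement {N : ℕ} (t : Fin (N + 1) → ℝ) (x : Fin (N + 1) → A → ℝ)
    (i : Fin (N + 1)) : Option A → ℝ :=
  fun o => o.elim (increment t i) fun a => increment (fun j => x j a) i

/-- The time-augmented signature of a path given by its coordinates. -/
noncomputable def pathSig {N : ℕ} (t : Fin (N + 1) → ℝ) (x : Fin (N + 1) → A → ℝ) :
    List (Option A) → ℝ :=
  expProd (pathIncrement t x)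

theorem increment_apply {N : ℕ} (x : Fin (N + 1) → EllTwo A) (i : Fin (N + 1)) (a : A) :
    (increment x i) a = increment (fun j => x j a) i := by
  refine Fin.cases ?_ (fun j => ?_) i <;> simp [increment]

theorem signature_apply {N : ℕ} (t : Fin (N + 1) → ℝ) (x : Fin (N + 1) → EllTwo A)
    (w : List (Option A)) : signature t x w = pathSig t (fun i a => x i a) w := by
  change signatureCoeff t x w = _
  rw [signatureCoeff, pathSig, expProd]
  have h : ∀ i, augment (increment t i) (increment x i) =
      pathIncrement t (fun i a => x i a) i := by
    intro i
    funext o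
    cases o with
    | none => rfl
    | some a => exact increment_apply x i a
  simp_rw [h]

theorem eq_of_increment_eq {E : Type*} [AddGroup E] {N : ℕ} {x y : Fin (N + 1) → E}
    (h : ∀ i, increment x i = increment y i) : x = y := by
  funext i
  induction i using Fin.induction with
  | zero => simpa [increment] using h 0
  | succ i ih =>
    have := h i.succ
    simp only [increment, Fin.cases_succ, ih] at this
    exact sub_left_injective this

/-- Moments of a piecewise linear path determine its increments. -/
theorem eq_zero_of_moments {N : ℕ} {t : Fin (N + 1) → ℝ} (ht0 : t 0 = 0) (ht : StrictMono t)
    (b : Fin N → ℝ) (c : ℝ)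
    (h : ∀ k : ℕ, (if k = 1 then c else 0) +
      ∑ j : Fin N, b j * (t j.succ ^ k - t j.castSucc ^ k) = 0) : b = 0 := by
  -- By linearity the moment identities extend from monomials to all polynomials.
  have hP : ∀ P : Polynomial ℝ, P.coeff 1 * c +
      ∑ j : Fin N, b j * (P.eval (t j.succ) - P.eval (t j.castSucc)) = 0 := by
    intro P
    induction P using Polynomial.induction_on' with
    | add p q hp hq =>
      simp only [Polynomial.coeff_add, Polynomial.eval_add]
      rw [← add_zero (0 : ℝ)]
      nth_rewrite 1 [← hp]
      rw [← hq]
      have : ∀ j : Fin N, b j * (p.eval (t j.succ) + q.eval (t j.succ) -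
          (p.eval (t j.castSucc) + q.eval (t j.castSucc))) =
          b j * (p.eval (t j.succ) - p.eval (t j.castSucc)) +
          b j * (q.eval (t j.succ) - q.eval (t j.castSucc)) := fun j => by ring
      simp_rw [this, Finset.sum_add_distrib]
      ring
    | monomial k r =>
      rw [← mul_zero r, ← h k, mul_add, Finset.mul_sum]
      congr 1
      · rw [Polynomial.coeff_monomial]
        split_ifs <;> simp
      · refine Finset.sum_congr rfl fun j _ => ?_
        simp only [Polynomial.eval_monomial]
        ring
  funext i
  -- The test polynomial `X * L` equals 1 at the nodes after `i` and 0 at the others, so only the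
  -- `i`-th difference survives. Since `L` vanishes at `t 0 = 0`, its linear coefficient is zero and
  -- the unknown `c` drops out.
  let L := Lagrange.interpolate Finset.univ t fun l => if i.castSucc < l then (t l)⁻¹ else 0
  have hL : ∀ l, L.eval (t l) = if i.castSucc < l then (t l)⁻¹ else 0 := fun l =>
    Lagrange.eval_interpolate_at_node _ ht.injective.injOn (Finset.mem_univ l)
  have hE : ∀ l, (Polynomial.X * L).eval (t l) = if i.castSucc < l then 1 else 0 := by
    intro l
    rw [Polynomial.eval_mul, Polynomial.eval_X, hL]
    split_ifs with hl
    · refine mul_inv_cancel₀ (ne_of_gt ?_)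
      rw [← ht0]
      exact ht (lt_of_le_of_lt (Fin.zero_le _) hl)
    · simp
  have hc : (Polynomial.X * L).coeff 1 = 0 := by
    rw [Polynomial.coeff_X_mul, Polynomial.coeff_zero_eq_eval_zero]
    simpa [ht0] using hL 0
  have := hP (Polynomial.X * L)
  rw [hc, zero_mul, zero_add, Finset.sum_eq_single i] at this
  · simpa [hE] using this
  · intro j _ hj
    have hiff : (i.castSucc < j.succ) ↔ (i.castSucc < j.castSucc) := by
      have : (i : ℕ) ≠ j := fun h => hj (Fin.ext h.symm)
      simp only [Fin.lt_def, Fin.val_castSucc, Fin.val_succ]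
      omega
    simp only [hE, hiff, sub_self, mul_zero]
  · simp

/-- Words with a single spatial letter, placed last, suffice: after multiplication by `X`, their
generating series encodes the moments of the slopes of the difference of two paths. -/
theorem pathSig_injective {N : ℕ} {t : Fin (N + 1) → ℝ} (ht0 : t 0 = 0) (ht : StrictMono t) :
    Function.Injective (pathSig (A := A) t) := by
  intro x y hxy
  funext i a
  refine congrFun (eq_of_increment_eq (x := fun j => x j a) (y := fun j => y j a) fun l => ?_) i
  clear i
  -- The grid with `t₋₁ = 0` in front. As `t 0 = 0` too, the first step has length zero and
  -- contributes the initial value as a constant series.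
  let s : Fin (N + 2) → ℝ := Fin.cons 0 t
  have hs : ∀ i : Fin (N + 1), increment t i = s i.succ - s i.castSucc := by
    refine Fin.cases ?_ fun j => ?_
    · simp [increment, s]
    · rw [← Fin.succ_castSucc]
      simp [increment, s]
  have key : ∀ z : Fin (N + 1) → A → ℝ, timeSeries (pathSig t z) a =
      C (increment (fun j => z j a) 0) + ∑ i : Fin N, C (increment (fun j => z j a) i.succ) *
        (expSeries (t i.castSucc) * expDivSeries (t i.succ - t i.castSucc)) := by
    intro z
    have h := timeSeries_expProd s (pathIncrement t z) hs a
    have h1 : expDivSeries 0 = 1 := by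
      ext k
      rw [expDivSeries, coeff_mk, coeff_one]
      rcases k with _ | k <;> simp
    rw [Fin.sum_univ_succ] at h
    simp only [← Fin.succ_castSucc] at h
    simpa [s, expSeries_zero, ht0, h1, pathIncrement, pathSig] using h
  let e : Fin (N + 1) → ℝ := fun l =>
    increment (fun j => x j a) l - increment (fun j => y j a) l
  suffices h : e = 0 from sub_eq_zero.1 (congrFun h l)
  have hτ : ∀ j : Fin N, t j.succ - t j.castSucc ≠ 0 := fun j =>
    sub_ne_zero.2 (ht (Fin.castSucc_lt_succ)).ne'
  have hser : C (e 0) + ∑ i : Fin N, C (e i.succ) *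
      (expSeries (t i.castSucc) * expDivSeries (t i.succ - t i.castSucc)) = 0 := by
    have h := (key x).symm.trans ((congrArg (fun G => timeSeries G a) hxy).trans (key y))
    rw [← sub_eq_zero] at h
    rw [← h]
    simp only [e, map_sub, sub_mul, Finset.sum_sub_distrib]
    ring
  -- Multiplying by `X` clears the denominators of `expDivSeries`; the increment is traded for the
  -- slope times a difference of exponentials.
  have hmul : ∀ j : Fin N, X * (C (e j.succ) *
      (expSeries (t j.castSucc) * expDivSeries (t j.succ - t j.castSucc))) =
      C (e j.succ / (t j.succ - t j.castSucc)) *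
        (expSeries (t j.succ) - expSeries (t j.castSucc)) := by
    intro j
    have h1 : expSeries (t j.succ) - expSeries (t j.castSucc) =
        expSeries (t j.castSucc) * (C (t j.succ - t j.castSucc) *
          (X * expDivSeries (t j.succ - t j.castSucc))) := by
      rw [X_mul_expDivSeries, mul_sub, expSeries_mul, add_sub_cancel, mul_one]
    have h2 : C (e j.succ) = C (e j.succ / (t j.succ - t j.castSucc)) *
        C (t j.succ - t j.castSucc) := by
      rw [← map_mul, div_mul_cancel₀ _ (hτ j)]
    rw [h1, h2]
    ring
  -- The `k`-th moment is `k!` times the `k`-th coefficient; the initial jump `e 0` appears only in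
  -- degree 1.
  have hb := eq_zero_of_moments ht0 ht (fun j => e j.succ / (t j.succ - t j.castSucc)) (e 0) <| by
    intro k
    have h := congrArg (fun p => (k ! : ℝ) * coeff k (X * p)) hser
    simp only [mul_add, Finset.mul_sum, hmul, map_add, map_sum, coeff_C_mul, map_sub,
      coeff_expSeries, mul_zero, map_zero] at h
    refine Eq.trans ?_ h
    have hk : (k ! : ℝ) ≠ 0 := by positivity
    congr 1
    · rw [mul_comm X, coeff_C_mul, coeff_X]
      split_ifs with h1
      · subst h1; simp
      · simp
    · refine Finset.sum_congr rfl fun j _ => ?_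
      field_simp
  have he : ∀ j : Fin N, e j.succ = 0 := fun j => by
    have := congrFun hb j
    simpa [hτ j] using this
  funext l
  refine Fin.cases ?_ he l
  simp only [he, map_zero, zero_mul, Finset.sum_const_zero, add_zero] at hser
  exact C_injective (by simpa using hser)

end Separation

/-! ### Square-summable bounds and integrability -/

section Domination

variable {A : Type*}

theorem abs_increment_le {N : ℕ} {x : Fin (N + 1) → ℝ} {c : ℝ} (h : ∀ i, |x i| ≤ c)
    (i : Fin (N + 1)) : |increment x i| ≤ 2 * c := by
  have hc : 0 ≤ c := (abs_nonneg _).trans (h 0)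
  refine Fin.cases ?_ (fun j => ?_) i
  · have : increment x 0 = x 0 := rfl
    rw [this]
    linarith [h 0]
  · have : increment x j.succ = x j.succ - x j.castSucc := rfl
    rw [this]
    linarith [abs_sub (x j.succ) (x j.castSucc), h j.succ, h j.castSucc]

/-- The signatures of all paths whose coordinates are bounded by a fixed element of `ℓ²` are
coordinatewise bounded by a fixed element of `ℓ²`. -/
theorem exists_forall_abs_pathSig_le {N : ℕ} (t : Fin (N + 1) → ℝ) (c : EllTwo A) :
    ∃ D : TensorHilbert (Option A), ∀ x : Fin (N + 1) → A → ℝ, (∀ i a, |x i a| ≤ c a) →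
      ∀ w, |pathSig t x w| ≤ D w := by
  -- A single majorant for all increments: the sum bounds every time step, and the factor 2 comes
  -- from differences of values bounded by `c`.
  let m : Option A → ℝ := augment (∑ i, |increment t i|) ((2 : ℝ) • c)
  have hm : Summable fun o => m o ^ 2 := summable_augment _ _
  have hD : Memℓp (expProd fun _ : Fin (N + 1) => m) 2 := by
    refine memℓp_gen ?_
    simpa using stronglySummable_expProd (v := fun _ : Fin (N + 1) => m) (fun _ => hm) 1 one_pos
  refine ⟨⟨_, hD⟩, fun x hx w => abs_expProd_le (fun i o => ?_) w⟩
  cases o with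
  | none =>
    change |increment t i| ≤ ∑ j, |increment t j|
    exact Finset.single_le_sum (f := fun j => |increment t j|) (fun _ _ => abs_nonneg _)
      (Finset.mem_univ i)
  | some a => exact abs_increment_le (fun j => hx j a) i

/-- The truncations to finitely many coordinates converge pointwise in norm; countability of `A`
makes this limit over finite sets countably generated. -/
theorem stronglyMeasurable_of_apply [Countable A] {Ω : Type*} [MeasurableSpace Ω]
    {f : Ω → EllTwo A} (hf : ∀ a, Measurable fun ω => f ω a) : StronglyMeasurable f := by
  classical
  refine stronglyMeasurable_of_tendsto (ι := Finset A) (u := Filter.atTop)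
    (f := fun s ω => ∑ a ∈ s, lp.single 2 a (f ω a)) (fun s => ?_) ?_
  · refine Finset.stronglyMeasurable_fun_sum _ fun a _ => ?_
    exact (lp.isometry_single a).continuous.comp_stronglyMeasurable (hf a).stronglyMeasurable
  · rw [tendsto_pi_nhds]
    exact fun ω => lp.hasSum_single (by norm_num) (f ω)

theorem norm_le_of_abs_le {f D : EllTwo A} (h : ∀ a, |f a| ≤ D a) : ‖f‖ ≤ ‖D‖ :=
  lp.norm_mono (by norm_num) fun a => (h a).trans (le_abs_self _)

theorem continuous_ellTwo_apply (a : A) : Continuous fun f : EllTwo A => f a :=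
  (lp.evalCLM ℝ (fun _ : A => ℝ) 2 a).continuous

theorem integral_ellTwo_apply {Ω : Type*} [MeasurableSpace Ω] {μ : Measure Ω}
    {f : Ω → EllTwo A} (hf : Integrable f μ) (a : A) :
    (∫ ω, f ω ∂μ) a = ∫ ω, f ω a ∂μ :=
  ((lp.evalCLM ℝ (fun _ : A => ℝ) 2 a).integral_comp_comm hf).symm

theorem continuous_pathSig {N : ℕ} (t : Fin (N + 1) → ℝ) (w : List (Option A)) :
    Continuous fun x : Fin (N + 1) → A → ℝ => pathSig t x w := by
  refine (continuous_expProd w).comp ?_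
  refine continuous_pi fun i => continuous_pi fun o => ?_
  cases o with
  | none => exact continuous_const
  | some a =>
    refine Fin.cases ?_ (fun j => ?_) i
    · exact (by fun_prop : Continuous fun x : Fin (N + 1) → A → ℝ => x 0 a)
    · exact (by fun_prop : Continuous fun x : Fin (N + 1) → A → ℝ => x j.succ a - x j.castSucc a)

end Domination

/-! ### Density of signature coefficients on a box -/

section Density

variable {A : Type*} {N : ℕ}

/-- The compact set of paths whose coordinates are bounded by `c`. -/
abbrev PathBox (N : ℕ) (c : A → ℝ) : Type _ := Fin (N + 1) → (a : A) → Set.Icc (-c a) (c a)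

/-- A coefficient of the signature as a continuous function on a box of paths. -/
noncomputable def boxSig (t : Fin (N + 1) → ℝ) (c : A → ℝ) (w : List (Option A)) :
    C(PathBox N c, ℝ) where
  toFun z := pathSig t (fun i a => z i a) w
  continuous_toFun := (continuous_pathSig t w).comp (by fun_prop)

theorem boxSig_mul (t : Fin (N + 1) → ℝ) (c : A → ℝ) (u v : List (Option A)) :
    boxSig t c u * boxSig t c v = ((shuffle u v).map (boxSig t c)).sum := by
  ext z
  have h := isShuffleCharacter_expProd (pathIncrement t fun i a => (z i a : ℝ)) u v
  refine h.symm.trans ?_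
  have : ∀ l : List (List (Option A)),
      (l.map (expProd (pathIncrement t fun i a => (z i a : ℝ)))).sum =
        (l.map (boxSig t c)).sum z := by
    intro l
    induction l with
    | nil => simp
    | cons w l ih => simp only [List.map_cons, List.sum_cons, ih]; rfl
  exact this _

theorem closure_span_boxSig {t : Fin (N + 1) → ℝ} (ht0 : t 0 = 0) (ht : StrictMono t)
    (c : A → ℝ) (f : C(PathBox N c, ℝ)) :
    f ∈ closure (Submodule.span ℝ (Set.range (boxSig t c)) : Set C(PathBox N c, ℝ)) := by
  let V := Submodule.span ℝ (Set.range (boxSig t c))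
  have hone : (1 : C(PathBox N c, ℝ)) ∈ V := by
    refine Submodule.subset_span ⟨[], ?_⟩
    ext z
    exact expProd_nil _
  have hmul : ∀ f g, f ∈ V → g ∈ V → f * g ∈ V := by
    intro f g hf hg
    induction hf, hg using Submodule.span_induction₂ with
    | mem_mem f g hf hg =>
      obtain ⟨u, rfl⟩ := hf
      obtain ⟨v, rfl⟩ := hg
      rw [boxSig_mul]
      refine list_sum_mem fun h hh => ?_
      obtain ⟨w, -, rfl⟩ := List.mem_map.1 hh
      exact Submodule.subset_span ⟨w, rfl⟩
    | zero_left => simp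
    | zero_right => simp
    | add_left _ _ _ _ _ _ h₁ h₂ => rw [add_mul]; exact V.add_mem h₁ h₂
    | add_right _ _ _ _ _ _ h₁ h₂ => rw [mul_add]; exact V.add_mem h₁ h₂
    | smul_left r _ _ _ _ h => rw [smul_mul_assoc]; exact V.smul_mem r h
    | smul_right r _ _ _ _ h => rw [mul_smul_comm]; exact V.smul_mem r h
  have hsep : (V.toSubalgebra hone hmul).SeparatesPoints := by
    intro y z hyz
    by_contra! hcon
    refine hyz ?_
    have h : pathSig t (fun i a => (y i a : ℝ)) = pathSig t (fun i a => (z i a : ℝ)) := by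
      funext w
      exact hcon _ ⟨boxSig t c w, Submodule.subset_span ⟨w, rfl⟩, rfl⟩
    funext i a
    exact Subtype.ext (congrFun (congrFun (pathSig_injective ht0 ht h) i) a)
  have h := ContinuousMap.subalgebra_topologicalClosure_eq_top_of_separatesPoints _ hsep
  have hf : f ∈ (V.toSubalgebra hone hmul).topologicalClosure := h ▸ Algebra.mem_top
  exact hf

/-- Transfers linear properties that are stable under uniform limits from signature coefficients to
all continuous functions; used for equality of integrals and for measurability in a parameter. -/
theorem boxSig_induction {t : Fin (N + 1) → ℝ} (ht0 : t 0 = 0) (ht : StrictMono t)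
    {c : A → ℝ} {p : C(PathBox N c, ℝ) → Prop} (h_sig : ∀ w, p (boxSig t c w))
    (h_zero : p 0) (h_add : ∀ f g, p f → p g → p (f + g))
    (h_smul : ∀ (r : ℝ) f, p f → p (r • f))
    (h_lim : ∀ (u : ℕ → C(PathBox N c, ℝ)) f, (∀ n, p (u n)) →
      Filter.Tendsto u Filter.atTop (nhds f) → p f) (f : C(PathBox N c, ℝ)) : p f := by
  obtain ⟨u, hu, hlim⟩ := mem_closure_iff_seq_limit.1 (closure_span_boxSig ht0 ht c f)
  refine h_lim u f (fun n => ?_) hlim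
  refine Submodule.span_induction (p := fun g _ => p g) ?_ h_zero (fun _ _ _ _ => h_add _ _)
    (fun r _ _ => h_smul r _) (hu n)
  rintro _ ⟨w, rfl⟩
  exact h_sig w

theorem integrable_continuousMap {Z : Type*} [TopologicalSpace Z] [CompactSpace Z]
    [MeasurableSpace Z] [OpensMeasurableSpace Z] (μ : Measure Z) [IsFiniteMeasure μ]
    (f : C(Z, ℝ)) : Integrable f μ :=
  Integrable.of_bound f.continuous.measurable.aestronglyMeasurable ‖f‖
    (ae_of_all _ f.norm_coe_le_norm)

theorem tendsto_integral_continuousMap {Z : Type*} [TopologicalSpace Z] [CompactSpace Z]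
    [MeasurableSpace Z] [OpensMeasurableSpace Z] (μ : Measure Z) [IsFiniteMeasure μ]
    {u : ℕ → C(Z, ℝ)} {f : C(Z, ℝ)} (h : Filter.Tendsto u Filter.atTop (nhds f)) :
    Filter.Tendsto (fun n => ∫ z, u n z ∂μ) Filter.atTop (nhds (∫ z, f z ∂μ)) := by
  rw [tendsto_iff_norm_sub_tendsto_zero] at h ⊢
  refine squeeze_zero (fun _ => norm_nonneg _) (fun n => ?_) (g := fun n => ‖u n - f‖ * μ.real .univ)
    (by simpa using h.mul_const (μ.real Set.univ))
  rw [← integral_sub (integrable_continuousMap μ _) (integrable_continuousMap μ _)]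
  exact norm_integral_le_of_norm_le_const (ae_of_all _ (u n - f).norm_coe_le_norm)

/-- A finite measure on a box of paths is determined by the expected signature. -/
theorem boxMeasure_ext [Countable A] {t : Fin (N + 1) → ℝ} (ht0 : t 0 = 0) (ht : StrictMono t)
    {c : A → ℝ} {μ ν : Measure (PathBox N c)} [IsFiniteMeasure μ] [IsFiniteMeasure ν]
    (h : ∀ w, ∫ z, boxSig t c w z ∂μ = ∫ z, boxSig t c w z ∂ν) : μ = ν := by
  have key : ∀ f : C(PathBox N c, ℝ), ∫ z, f z ∂μ = ∫ z, f z ∂ν := by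
    refine boxSig_induction ht0 ht h (by simp) (fun f g hf hg => ?_) (fun r f hf => ?_)
      fun u f hu hlim => ?_
    · simp only [ContinuousMap.add_apply]
      rw [integral_add (integrable_continuousMap μ f) (integrable_continuousMap μ g),
        integral_add (integrable_continuousMap ν f) (integrable_continuousMap ν g), hf, hg]
    · simp only [ContinuousMap.smul_apply, integral_smul, hf]
    · have h1 := tendsto_integral_continuousMap μ hlim
      simp_rw [hu] at h1
      exact tendsto_nhds_unique h1 (tendsto_integral_continuousMap ν hlim)
  exact ext_of_forall_integral_eq_of_IsFiniteMeasure fun f => key f.toContinuousMap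

/-- A family of probability measures on a box of paths depends measurably on the parameter if the
coefficients of the expected signatures do. -/
theorem measurable_boxMeasure [Countable A] {t : Fin (N + 1) → ℝ} (ht0 : t 0 = 0)
    (ht : StrictMono t) {c : A → ℝ} {α : Type*} [MeasurableSpace α] {κ : α → Measure (PathBox N c)}
    [∀ a, IsProbabilityMeasure (κ a)]
    (h : ∀ w, Measurable fun a => ∫ z, boxSig t c w z ∂κ a) : Measurable κ := by
  have key : ∀ f : C(PathBox N c, ℝ), Measurable fun a => ∫ z, f z ∂κ a := by
    refine boxSig_induction ht0 ht h (by simp) (fun f g hf hg => ?_) (fun r f hf => ?_)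
      fun u f hu hlim => ?_
    · simp only [ContinuousMap.add_apply]
      simp_rw [integral_add (integrable_continuousMap _ f) (integrable_continuousMap _ g)]
      exact hf.add hg
    · simp only [ContinuousMap.smul_apply, integral_smul]
      exact hf.const_smul r
    · exact measurable_of_tendsto_metrizable hu
        (tendsto_pi_nhds.2 fun a => tendsto_integral_continuousMap (κ a) hlim)
  -- Closed sets form a generating π-system, and their indicators are limits of the continuous
  -- functions `apprSeq`.
  refine Measurable.measure_of_isPiSystem_of_isProbabilityMeasure
    ((BorelSpace.measurable_eq (α := PathBox N c)).trans borel_eq_generateFrom_isClosed)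
    isPiSystem_isClosed fun F hF => ?_
  refine measurable_of_tendsto_metrizable (fun n => ?_)
    (tendsto_pi_nhds.2 fun a => HasOuterApproxClosed.tendsto_lintegral_apprSeq hF (κ a))
  let g : C(PathBox N c, ℝ) := ⟨fun z => hF.apprSeq n z, by fun_prop⟩
  have hg : ∀ a, ∫⁻ z, hF.apprSeq n z ∂κ a = ENNReal.ofReal (∫ z, g z ∂κ a) := fun a =>
    lintegral_coe_eq_integral _ (integrable_continuousMap (κ a) g)
  simp_rw [hg]
  exact (key g).ennreal_ofReal

/-- The projection of paths to a box. -/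
noncomputable def clampPath {c : A → ℝ} (hc : ∀ a, 0 ≤ c a) (x : Fin (N + 1) → A → ℝ) :
    PathBox N c :=
  fun i a => Set.projIcc (-c a) (c a) (by linarith [hc a]) (x i a)

theorem clampPath_eq {c : A → ℝ} (hc : ∀ a, 0 ≤ c a) {x : Fin (N + 1) → A → ℝ}
    (hx : ∀ i a, |x i a| ≤ c a) : (fun i a => (clampPath hc x i a : ℝ)) = x := by
  funext i a
  exact congrArg Subtype.val (Set.projIcc_of_mem _ (abs_le.1 (hx i a)))

theorem measurable_clampPath {c : A → ℝ} (hc : ∀ a, 0 ≤ c a) :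
    Measurable (clampPath (N := N) hc) := by
  refine measurable_pi_lambda _ fun i => measurable_pi_lambda _ fun a => ?_
  exact continuous_projIcc.measurable.comp (by fun_prop)

theorem measurable_pathBox_val {c : A → ℝ} :
    Measurable fun (z : PathBox N c) i a => (z i a : ℝ) := by
  fun_prop

/-- Almost surely the path already lies in the box, so clamping only changes the type to a compact
space. -/
theorem integral_map_clampPath [Countable A] (t : Fin (N + 1) → ℝ) {c : A → ℝ} (hc : ∀ a, 0 ≤ c a)
    {Ω : Type*} [MeasurableSpace Ω] {μ : Measure Ω} {U : Ω → Fin (N + 1) → A → ℝ}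
    (hU : Measurable U) (hb : ∀ᵐ ω ∂μ, ∀ i a, |U ω i a| ≤ c a) (w : List (Option A)) :
    ∫ z, boxSig t c w z ∂μ.map (clampPath hc ∘ U) = ∫ ω, pathSig t (U ω) w ∂μ := by
  rw [integral_map ((measurable_clampPath hc).comp hU).aemeasurable
    (boxSig t c w).continuous.measurable.aestronglyMeasurable]
  refine integral_congr_ae ?_
  filter_upwards [hb] with ω hω
  change pathSig t (fun i a => (clampPath hc (U ω) i a : ℝ)) w = _
  rw [clampPath_eq hc hω]

/-- The law of a bounded random path is determined by its expected signature. -/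
theorem map_eq_map_of_integral_pathSig_eq [Countable A] {t : Fin (N + 1) → ℝ} (ht0 : t 0 = 0)
    (ht : StrictMono t) {c : A → ℝ} (hc : ∀ a, 0 ≤ c a)
    {Ω Ω' : Type*} [MeasurableSpace Ω] [MeasurableSpace Ω'] {P : Measure Ω} {Q : Measure Ω'}
    [IsFiniteMeasure P] [IsFiniteMeasure Q]
    {U : Ω → Fin (N + 1) → A → ℝ} {V : Ω' → Fin (N + 1) → A → ℝ}
    (hU : Measurable U) (hV : Measurable V)
    (hUb : ∀ᵐ ω ∂P, ∀ i a, |U ω i a| ≤ c a) (hVb : ∀ᵐ ω ∂Q, ∀ i a, |V ω i a| ≤ c a)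
    (h : ∀ w, ∫ ω, pathSig t (U ω) w ∂P = ∫ ω, pathSig t (V ω) w ∂Q) :
    P.map U = Q.map V := by
  have hbox : P.map (clampPath hc ∘ U) = Q.map (clampPath hc ∘ V) :=
    boxMeasure_ext ht0 ht fun w => by
      rw [integral_map_clampPath t hc hU hUb, integral_map_clampPath t hc hV hVb, h]
  have h1 : P.map U =
      (P.map (clampPath hc ∘ U)).map fun z i a => (z i a : ℝ) := by
    rw [Measure.map_map measurable_pathBox_val ((measurable_clampPath hc).comp hU)]
    refine Measure.map_congr ?_
    filter_upwards [hUb] with ω hω using (clampPath_eq hc hω).symm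
  have h2 : Q.map V =
      (Q.map (clampPath hc ∘ V)).map fun z i a => (z i a : ℝ) := by
    rw [Measure.map_map measurable_pathBox_val ((measurable_clampPath hc).comp hV)]
    refine Measure.map_congr ?_
    filter_upwards [hVb] with ω hω using (clampPath_eq hc hω).symm
  rw [h1, h2, hbox]

/-- A family of laws of bounded paths depends measurably on the parameter if the coefficients of
the expected signatures do. -/
theorem measurable_of_integral_pathSig [Countable A] {t : Fin (N + 1) → ℝ} (ht0 : t 0 = 0)
    (ht : StrictMono t) {c : A → ℝ} (hc : ∀ a, 0 ≤ c a)
    {α : Type*} [MeasurableSpace α] {κ : α → Measure (Fin (N + 1) → A → ℝ)}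
    [∀ a, IsProbabilityMeasure (κ a)]
    (hb : ∀ a, ∀ᵐ x ∂κ a, ∀ i b, |x i b| ≤ c b)
    (h : ∀ w, Measurable fun a => ∫ x, pathSig t x w ∂κ a) : Measurable κ := by
  have hprob : ∀ a, IsProbabilityMeasure ((κ a).map (clampPath hc)) := fun a =>
    Measure.isProbabilityMeasure_map (measurable_clampPath hc).aemeasurable
  have hbox : Measurable fun a => (κ a).map (clampPath hc) :=
    measurable_boxMeasure ht0 ht fun w => by
      have := fun a => integral_map_clampPath t hc (U := id) measurable_id (hb a) w
      simp only [Function.comp_id, id] at this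
      simpa only [this] using h w
  have h1 : κ = fun a => ((κ a).map (clampPath hc)).map fun z i b => (z i b : ℝ) := by
    funext a
    rw [Measure.map_map measurable_pathBox_val (measurable_clampPath hc)]
    conv_lhs => rw [← Measure.map_id (μ := κ a)]
    refine Measure.map_congr ?_
    filter_upwards [hb a] with x hx using (clampPath_eq hc hx).symm
  rw [h1]
  exact (Measure.measurable_map _ measurable_pathBox_val).comp hbox

end Density

/-! ### Expected signatures of bounded paths -/

section ExpectedSignature

variable {N d : ℕ}

/-- The coordinates of a path in `ℝ^d`. -/
def pathCoord (x : PathSpace N d) (i : Fin (N + 1)) (j : Fin d) : ℝ := x i j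

theorem measurable_pathCoord : Measurable (pathCoord (N := N) (d := d)) := by
  refine measurable_pi_lambda _ fun i => measurable_pi_lambda _ fun j => ?_
  exact Continuous.measurable (by unfold pathCoord; fun_prop)

/-- The set of paths in `ℝ^d` whose coordinates are bounded by `c`. -/
def boundedPaths (N d : ℕ) (c : ℝ) : Set (PathSpace N d) := {x | ∀ i j, |pathCoord x i j| ≤ c}

theorem measurableSet_boundedPaths (c : ℝ) : MeasurableSet (boundedPaths N d c) := by
  simp only [boundedPaths, Set.ofPred_forall]
  refine MeasurableSet.iInter fun i => MeasurableSet.iInter fun j => ?_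
  have h : Measurable fun x : PathSpace N d => |pathCoord x i j| :=
    ((measurable_pi_apply j).comp ((measurable_pi_apply i).comp measurable_pathCoord)).abs
  exact measurableSet_le h measurable_const

theorem sigOne_apply (t : Fin (N + 1) → ℝ) (x : PathSpace N d) (w : List (Option (Fin d))) :
    sigOne t x w = pathSig t (pathCoord x) w :=
  signature_apply _ _ _

theorem exists_forall_abs_sigOne_le (t : Fin (N + 1) → ℝ) (c : ℝ) :
    ∃ D : HilbertOne d, ∀ x ∈ boundedPaths N d c, ∀ w, |sigOne t x w| ≤ D w := by
  obtain ⟨D, hD⟩ := exists_forall_abs_pathSig_le t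
    (⟨fun _ => c, Memℓp.all _⟩ : EllTwo (Fin d))
  refine ⟨D, fun x hx w => ?_⟩
  rw [sigOne_apply]
  exact hD _ hx w

theorem stronglyMeasurable_sigOne (t : Fin (N + 1) → ℝ) :
    StronglyMeasurable (sigOne (d := d) t) := by
  refine stronglyMeasurable_of_apply fun w => ?_
  simp_rw [sigOne_apply]
  exact (continuous_pathSig t w).measurable.comp measurable_pathCoord

theorem integrable_sigOne (t : Fin (N + 1) → ℝ) {c : ℝ} {μ : Measure (PathSpace N d)}
    [IsFiniteMeasure μ] (hμ : ∀ᵐ x ∂μ, x ∈ boundedPaths N d c) : Integrable (sigOne t) μ := by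
  obtain ⟨D, hD⟩ := exists_forall_abs_sigOne_le (d := d) t c
  refine Integrable.of_bound (stronglyMeasurable_sigOne t).aestronglyMeasurable ‖D‖ ?_
  filter_upwards [hμ] with x hx using norm_le_of_abs_le (hD x hx)

theorem integral_sigOne_apply (t : Fin (N + 1) → ℝ) {c : ℝ} {μ : Measure (PathSpace N d)}
    [IsFiniteMeasure μ] (hμ : ∀ᵐ x ∂μ, x ∈ boundedPaths N d c) (w : List (Option (Fin d))) :
    (∫ x, sigOne t x ∂μ) w = ∫ x, pathSig t (pathCoord x) w ∂μ := by
  rw [integral_ellTwo_apply (integrable_sigOne t hμ)]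
  simp_rw [sigOne_apply]

/-- The coordinates of the path of expected signatures of a path of measures. -/
noncomputable def expectedSigCoord (t : Fin (N + 1) → ℝ)
    (μ : Fin (N + 1) → ProbabilityMeasure (PathSpace N d)) (i : Fin (N + 1))
    (w : List (Option (Fin d))) : ℝ :=
  (∫ x, sigOne t x ∂(μ i : Measure (PathSpace N d))) w

theorem measurable_expectedSigCoord (t : Fin (N + 1) → ℝ) :
    Measurable (expectedSigCoord (d := d) t) := by
  refine measurable_pi_lambda _ fun i => measurable_pi_lambda _ fun w => ?_
  -- The tautological kernel, sending a measure to itself.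
  let κ : Kernel (ProbabilityMeasure (PathSpace N d)) (PathSpace N d) :=
    ⟨Subtype.val, measurable_subtype_coe⟩
  have h : StronglyMeasurable fun μ : ProbabilityMeasure (PathSpace N d) =>
      ∫ x, sigOne t x ∂κ μ := (stronglyMeasurable_sigOne t).integral_kernel
  have h' := ((continuous_ellTwo_apply w).comp_stronglyMeasurable h).measurable
  exact h'.comp (measurable_pi_apply i)

theorem sigTwo_apply (t : Fin (N + 1) → ℝ)
    (μ : Fin (N + 1) → ProbabilityMeasure (PathSpace N d))
    (w : List (Option (List (Option (Fin d))))) :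
    sigTwo t μ w = pathSig t (expectedSigCoord t μ) w :=
  signature_apply _ _ _

theorem stronglyMeasurable_sigTwo (t : Fin (N + 1) → ℝ) :
    StronglyMeasurable (sigTwo (d := d) t) := by
  refine stronglyMeasurable_of_apply fun w => ?_
  simp_rw [sigTwo_apply]
  exact (continuous_pathSig t w).measurable.comp (measurable_expectedSigCoord t)

/-- The paths of probability measures that are supported by the paths bounded by `c`. -/
def boundedMeasurePaths (N d : ℕ) (c : ℝ) :
    Set (Fin (N + 1) → ProbabilityMeasure (PathSpace N d)) :=
  {μ | ∀ i, ∀ᵐ x ∂(μ i : Measure (PathSpace N d)), x ∈ boundedPaths N d c}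

theorem exists_forall_abs_expectedSigCoord_le (t : Fin (N + 1) → ℝ) (c : ℝ) :
    ∃ D : HilbertOne d, (∀ w, 0 ≤ D w) ∧ ∀ μ ∈ boundedMeasurePaths N d c, ∀ i w,
      |expectedSigCoord t μ i w| ≤ D w := by
  obtain ⟨D, hD⟩ := exists_forall_abs_sigOne_le (d := d) t c
  -- If no path is bounded by `c`, nothing forces `D` to be nonnegative; the absolute value makes it
  -- a valid box size in every case.
  have hmem : Memℓp (fun w => |D w|) 2 := (memℓp_norm_iff (f := fun w => D w)).2 (lp.memℓp D)
  refine ⟨⟨_, hmem⟩, fun w => abs_nonneg _, fun μ hμ i w => ?_⟩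
  rw [expectedSigCoord, integral_ellTwo_apply (integrable_sigOne t (hμ i))]
  have h : ∀ᵐ x ∂(μ i : Measure (PathSpace N d)), ‖sigOne t x w‖ ≤ |D w| := by
    filter_upwards [hμ i] with x hx using (hD x hx w).trans (le_abs_self _)
  simpa using norm_integral_le_of_norm_le_const h

theorem exists_forall_norm_sigTwo_le (t : Fin (N + 1) → ℝ) (c : ℝ) :
    ∃ C : ℝ, ∀ μ ∈ boundedMeasurePaths N d c, ‖sigTwo t μ‖ ≤ C := by
  obtain ⟨D, -, hD⟩ := exists_forall_abs_expectedSigCoord_le (d := d) t c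
  obtain ⟨E, hE⟩ := exists_forall_abs_pathSig_le t D
  refine ⟨‖E‖, fun μ hμ => norm_le_of_abs_le fun w => ?_⟩
  rw [sigTwo_apply]
  exact hE _ (hD μ hμ) w

/-- On the paths of measures with bounded support, the σ-algebra generated by the expected
signatures is the full one. -/
theorem exists_preimage_expectedSigCoord {t : Fin (N + 1) → ℝ} (ht0 : t 0 = 0)
    (ht : StrictMono t) {c : ℝ} (hc : 0 ≤ c)
    {E : Set (Fin (N + 1) → ProbabilityMeasure (PathSpace N d))} (hE : MeasurableSet E) :
    ∃ C : Set (Fin (N + 1) → List (Option (Fin d)) → ℝ), MeasurableSet C ∧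
      ∀ μ ∈ boundedMeasurePaths N d c, μ ∈ E ↔ expectedSigCoord t μ ∈ C := by
  let F : boundedMeasurePaths N d c → Fin (N + 1) → List (Option (Fin d)) → ℝ :=
    fun μ => expectedSigCoord t μ
  -- With the σ-algebra pulled back along `F`, measurable sets are preimages under `F`, so the claim
  -- becomes measurability of the inclusion.
  let m : MeasurableSpace (boundedMeasurePaths N d c) := MeasurableSpace.comap F inferInstance
  have hF : Measurable[m] F := comap_measurable F
  have hval : Measurable[m] (Subtype.val : boundedMeasurePaths N d c → _) := by
    refine measurable_pi_lambda _ fun i => Measurable.subtype_mk ?_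
    have hb : ∀ μ : boundedMeasurePaths N d c,
        ∀ᵐ x ∂(μ.1 i : Measure (PathSpace N d)).map pathCoord, ∀ l j, |x l j| ≤ c := by
      intro μ
      have hs : MeasurableSet {x : Fin (N + 1) → Fin d → ℝ | ∀ l j, |x l j| ≤ c} := by
        simp only [Set.ofPred_forall]
        refine MeasurableSet.iInter fun l => MeasurableSet.iInter fun j => ?_
        exact measurableSet_le (by fun_prop) measurable_const
      rw [ae_map_iff measurable_pathCoord.aemeasurable hs]
      exact μ.2 i
    have hprob : ∀ μ : boundedMeasurePaths N d c,
        IsProbabilityMeasure ((μ.1 i : Measure (PathSpace N d)).map pathCoord) := fun μ =>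
      Measure.isProbabilityMeasure_map measurable_pathCoord.aemeasurable
    have h1 : Measurable[m] fun μ : boundedMeasurePaths N d c =>
        (μ.1 i : Measure (PathSpace N d)).map pathCoord := by
      refine measurable_of_integral_pathSig ht0 ht (c := fun _ => c) (fun _ => hc) hb fun w => ?_
      have h2 : ∀ μ : boundedMeasurePaths N d c,
          ∫ x, pathSig t x w ∂(μ.1 i : Measure (PathSpace N d)).map pathCoord = F μ i w := by
        intro μ
        rw [integral_map measurable_pathCoord.aemeasurable
          (continuous_pathSig t w).measurable.aestronglyMeasurable]
        exact (integral_sigOne_apply t (μ.2 i) w).symm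
      simp_rw [h2]
      exact (measurable_pi_apply w).comp ((measurable_pi_apply i).comp hF)
    let G : (Fin (N + 1) → Fin d → ℝ) → PathSpace N d := fun y l => WithLp.toLp 2 (y l)
    have hG : Measurable G := Continuous.measurable (by fun_prop)
    have h3 : (fun μ : boundedMeasurePaths N d c => (μ.1 i : Measure (PathSpace N d))) =
        fun μ => ((μ.1 i : Measure (PathSpace N d)).map pathCoord).map G := by
      funext μ
      rw [Measure.map_map hG measurable_pathCoord]
      exact Measure.map_id.symm
    exact h3 ▸ (Measure.measurable_map G hG).comp h1
  obtain ⟨C, hC, hCE⟩ := hval hE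
  exact ⟨C, hC, fun μ hμ => (Set.ext_iff.1 hCE ⟨μ, hμ⟩).symm⟩

/-- The law of a random path of measures with bounded support is determined by the law of its
path of expected signatures. -/
theorem map_eq_of_map_expectedSigCoord_eq {t : Fin (N + 1) → ℝ} (ht0 : t 0 = 0)
    (ht : StrictMono t) {c : ℝ} (hc : 0 ≤ c) {Ω Ω' : Type*} [MeasurableSpace Ω]
    [MeasurableSpace Ω'] {P : Measure Ω} {Q : Measure Ω'}
    {U : Ω → Fin (N + 1) → ProbabilityMeasure (PathSpace N d)}
    {V : Ω' → Fin (N + 1) → ProbabilityMeasure (PathSpace N d)}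
    (hU : Measurable U) (hV : Measurable V)
    (hUb : ∀ᵐ ω ∂P, U ω ∈ boundedMeasurePaths N d c)
    (hVb : ∀ᵐ ω ∂Q, V ω ∈ boundedMeasurePaths N d c)
    (h : P.map (expectedSigCoord t ∘ U) =
      Q.map (expectedSigCoord t ∘ V)) : P.map U = Q.map V := by
  ext E hE
  obtain ⟨C, hC, hCE⟩ := exists_preimage_expectedSigCoord ht0 ht hc hE
  rw [Measure.map_apply hU hE, Measure.map_apply hV hE]
  have hPC : P (U ⁻¹' E) = P.map (expectedSigCoord t ∘ U) C := by
    rw [Measure.map_apply ((measurable_expectedSigCoord t).comp hU) hC]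
    refine measure_congr ?_
    filter_upwards [hUb] with ω hω using propext (hCE _ hω)
  have hQC : Q (V ⁻¹' E) = Q.map (expectedSigCoord t ∘ V) C := by
    rw [Measure.map_apply ((measurable_expectedSigCoord t).comp hV) hC]
    refine measure_congr ?_
    filter_upwards [hVb] with ω hω using propext (hCE _ hω)
  rw [hPC, hQC, h]

end ExpectedSignature

/-! ### Prediction processes -/

section Prediction

/-- The joint law of `X` and `Y` is the law of `X` composed with the conditional distribution, so a
null event for `Y` is null under almost every conditional law. -/
theorem ae_condDistrib_mem {α β T : Type*} [MeasurableSpace α] [MeasurableSpace β]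
    [MeasurableSpace T] [StandardBorelSpace T] [Nonempty T] {μ : Measure α} [IsFiniteMeasure μ]
    {X : α → β} {Y : α → T} (hX : Measurable X) (hY : Measurable Y) {B : Set T}
    (hB : MeasurableSet B) (h : ∀ᵐ a ∂μ, Y a ∈ B) :
    ∀ᵐ a ∂μ, ∀ᵐ y ∂condDistrib Y X μ (X a), y ∈ B := by
  refine ae_of_ae_map hX.aemeasurable (p := fun b => ∀ᵐ y ∂condDistrib Y X μ b, y ∈ B) ?_
  refine Measure.ae_ae_of_ae_compProd (p := fun z : β × T => z.2 ∈ B) ?_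
  rw [compProd_map_condDistrib hY.aemeasurable,
    ae_map_iff (hX.prodMk hY).aemeasurable (measurable_snd hB)]
  exact h

variable {N d : ℕ} {Ω : Type*} {mΩ : MeasurableSpace Ω} {P : Measure Ω} [IsProbabilityMeasure P]
  {ℱ : Filtration (Fin (N + 1)) mΩ} {X : Fin (N + 1) → Ω → EuclideanSpace ℝ (Fin d)}

theorem measurable_pathOf (hX : Adapted ℱ X) : Measurable (pathOf X) :=
  measurable_pi_lambda _ fun i => (hX i).mono (ℱ.le i) le_rfl

theorem measurable_prediction : Measurable (prediction P ℱ X) := by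
  refine measurable_pi_lambda _ fun i => Measurable.subtype_mk ?_
  exact Measurable.mono (@Kernel.measurable Ω (PathSpace N d) (ℱ i) _
    (@condDistrib Ω Ω (PathSpace N d) _ _ _ mΩ (ℱ i) (pathOf X) id P _)) (ℱ.le i) le_rfl

theorem ae_prediction_mem_boundedMeasurePaths (hX : Adapted ℱ X) {c : ℝ}
    (hb : ∀ᵐ ω ∂P, pathOf X ω ∈ boundedPaths N d c) :
    ∀ᵐ ω ∂P, prediction P ℱ X ω ∈ boundedMeasurePaths N d c := by
  refine ae_all_iff.2 fun i => ?_
  exact @ae_condDistrib_mem Ω Ω (PathSpace N d) mΩ (ℱ i) _ _ _ P _ id (pathOf X)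
    (measurable_id.mono le_rfl (ℱ.le i)) (measurable_pathOf hX) _ (measurableSet_boundedPaths c) hb

theorem hasExpectedSignatures_of_bounded (t : Fin (N + 1) → ℝ) (hX : Adapted ℱ X) {c : ℝ}
    (hb : ∀ᵐ ω ∂P, pathOf X ω ∈ boundedPaths N d c) : HasExpectedSignatures t P ℱ X := by
  have hpred := ae_prediction_mem_boundedMeasurePaths hX hb
  refine ⟨?_, fun i => ?_, ?_⟩
  · obtain ⟨D, hD⟩ := exists_forall_abs_sigOne_le (d := d) t c
    refine Integrable.of_bound ((stronglyMeasurable_sigOne t).comp_measurable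
      (measurable_pathOf hX)).aestronglyMeasurable ‖D‖ ?_
    filter_upwards [hb] with ω hω using norm_le_of_abs_le (hD _ hω)
  · filter_upwards [hpred] with ω hω using integrable_sigOne t (hω i)
  · obtain ⟨C, hC⟩ := exists_forall_norm_sigTwo_le (d := d) t c
    refine Integrable.of_bound ((stronglyMeasurable_sigTwo t).comp_measurable
      measurable_prediction).aestronglyMeasurable C ?_
    filter_upwards [hpred] with ω hω using hC _ hω

theorem exists_bounded_of_isCompact {K : Set (EuclideanSpace ℝ (Fin d))} (hK : IsCompact K) :
    ∃ c : ℝ, 0 ≤ c ∧ ∀ x : PathSpace N d, (∀ i, x i ∈ K) → x ∈ boundedPaths N d c := by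
  obtain ⟨c, hc⟩ := hK.isBounded.exists_norm_le
  refine ⟨max c 0, le_max_right _ _, fun x hx i j => ?_⟩
  exact ((PiLp.norm_apply_le (x i) j).trans (hc _ (hx i))).trans (le_max_left _ _)

end Prediction

end RankTwoSignature

open RankTwoSignature
theorem theorem1 {N d : ℕ} (t : Fin (N + 1) → ℝ) (ht0 : t 0 = 0) (ht : StrictMono t)
    (K : Set (EuclideanSpace ℝ (Fin d))) (hK : IsCompact K)
    {Ω Ω' : Type*} {mΩ : MeasurableSpace Ω} {mΩ' : MeasurableSpace Ω'}
    (P : Measure Ω) [IsProbabilityMeasure P]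
    (Q : Measure Ω') [IsProbabilityMeasure Q]
    (ℱ : Filtration (Fin (N + 1)) mΩ)
    (𝒢 : Filtration (Fin (N + 1)) mΩ')
    (X : Fin (N + 1) → Ω → EuclideanSpace ℝ (Fin d))
    (Y : Fin (N + 1) → Ω' → EuclideanSpace ℝ (Fin d))
    (hX : Adapted ℱ X) (hY : Adapted 𝒢 Y)
    (hXK : ∀ i, ∀ᵐ ω ∂P, X i ω ∈ K) (hYK : ∀ i, ∀ᵐ ω ∂Q, Y i ω ∈ K) :
    HasExpectedSignatures t P ℱ X ∧
    HasExpectedSignatures t Q 𝒢 Y ∧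
    (P.map (pathOf X) = Q.map (pathOf Y) ↔
      ∫ ω, sigOne t (pathOf X ω) ∂P =
        ∫ ω, sigOne t (pathOf Y ω) ∂Q) ∧
    (P.map (prediction P ℱ X) = Q.map (prediction Q 𝒢 Y) ↔
      ∫ ω, sigTwo t (prediction P ℱ X ω) ∂P =
        ∫ ω, sigTwo t (prediction Q 𝒢 Y ω) ∂Q) := by
  obtain ⟨c, hc, hcK⟩ := exists_bounded_of_isCompact (N := N) hK
  have hXb : ∀ᵐ ω ∂P, pathOf X ω ∈ boundedPaths N d c := by
    filter_upwards [ae_all_iff.2 hXK] with ω hω using hcK _ hω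
  have hYb : ∀ᵐ ω ∂Q, pathOf Y ω ∈ boundedPaths N d c := by
    filter_upwards [ae_all_iff.2 hYK] with ω hω using hcK _ hω
  have hXs := hasExpectedSignatures_of_bounded t hX hXb
  have hYs := hasExpectedSignatures_of_bounded t hY hYb
  have hXm := measurable_pathOf hX
  have hYm := measurable_pathOf hY
  refine ⟨hXs, hYs, ⟨fun h => ?_, fun h => ?_⟩, ⟨fun h => ?_, fun h => ?_⟩⟩
  · have hS := stronglyMeasurable_sigOne (d := d) t
    rw [← integral_map hXm.aemeasurable hS.aestronglyMeasurable, h,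
      integral_map hYm.aemeasurable hS.aestronglyMeasurable]
  · have hcoord : P.map (pathCoord ∘ pathOf X) =
        Q.map (pathCoord ∘ pathOf Y) := by
      refine map_eq_map_of_integral_pathSig_eq ht0 ht (c := fun _ => c) (fun _ => hc)
        (measurable_pathCoord.comp hXm) (measurable_pathCoord.comp hYm) hXb hYb fun w => ?_
      simp only [Function.comp_apply, ← sigOne_apply]
      rw [← integral_ellTwo_apply hXs.1, ← integral_ellTwo_apply hYs.1, h]
    -- `G` inverts `pathCoord`, which carries equality of coordinate laws back to `PathSpace`.
    let G : (Fin (N + 1) → Fin d → ℝ) → PathSpace N d := fun y l => WithLp.toLp 2 (y l)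
    have hG : Measurable G := Continuous.measurable (by fun_prop)
    have h' := congrArg (Measure.map G) hcoord
    rw [Measure.map_map hG (measurable_pathCoord.comp hXm),
      Measure.map_map hG (measurable_pathCoord.comp hYm)] at h'
    exact h'
  · have hS := stronglyMeasurable_sigTwo (d := d) t
    rw [← integral_map measurable_prediction.aemeasurable hS.aestronglyMeasurable, h,
      integral_map measurable_prediction.aemeasurable hS.aestronglyMeasurable]
  · obtain ⟨D, hD0, hD⟩ := exists_forall_abs_expectedSigCoord_le (d := d) t c
    have hXp := ae_prediction_mem_boundedMeasurePaths hX hXb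
    have hYp := ae_prediction_mem_boundedMeasurePaths hY hYb
    refine map_eq_of_map_expectedSigCoord_eq ht0 ht hc measurable_prediction
      measurable_prediction hXp hYp ?_
    -- The rank-1 argument again, now with words as coordinates and the box given by the `ℓ²`
    -- majorant `D`.
    refine map_eq_map_of_integral_pathSig_eq ht0 ht (c := fun w => D w) hD0
      ((measurable_expectedSigCoord t).comp measurable_prediction)
      ((measurable_expectedSigCoord t).comp measurable_prediction)
      (by filter_upwards [hXp] with ω hω using hD _ hω)
      (by filter_upwards [hYp] with ω hω using hD _ hω) fun w => ?_
    simp only [Function.comp_apply, ← sigTwo_apply]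
    rw [← integral_ellTwo_apply hXs.2.2, ← integral_ellTwo_apply hYs.2.2, h]
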